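/- For integers $n\ge k\ge 0$, let $L_{n,k}$ be the set of truncated lecture hall partitions, i.e. nonincreasing sequences $\lambda=(\lambda_1,\dots,\lambda_k)$ of nonnegative integers with $$\frac{\lambda_1}{n}\ge\frac{\lambda_2}{n-1}\ge\cdots\ge\frac{\lambda_k}{n-k+1}\ge 0,$$ and let $\bar L_{n,k}\subseteq L_{n,k}$ be the subset of those all of whose $k$ parts are positive. Put $|\lambda_o|=\lambda_1+\lambda_3+\cdots$, $|\lambda_e|=\lambda_2+\lambda_4+\cdots$, $(a;q)_m=\prod_{i=0}^{m-1}(1-aq^i)$ and $\left[{N\atop m}\right]_q=(q^{N-m+1};q)_m/(q;q)_m$. **Theorem (Odd/Even Truncated Lecture Hall Theorem).** For all integers $n\ge k\ge 0$, as formal power series in $x,y$ (regarded in the fraction field of $\mathbb{Z}[[x,y]]$), $$\sum_{\lambda\in\bar L_{n,k}}x^{|\lambda_o|}y^{|\lambda_e|}=\frac{\left(x^{\lfloor k/2\rfloor+1}y^{\lfloor k/2\rfloor}\right)^{\lceil k/2\rceil}\left[{n-\lceil k/2\rceil\atop \lfloor k/2\rfloor}\right]_{xy}}{(x;xy)_{\lceil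 k/2\rceil}\,(x^ny^{n-1};(xy)^{-1})_{\lfloor k/2\rfloor}},$$ and $$\sum_{\lambda\in L_{n,k}}x^{|\lambda_o|}y^{|\lambda_e|}=\sum_{m=0}^{k}\frac{\left(x^{\lfloor m/2\rfloor+1}y^{\lfloor m/2\rfloor}\right)^{\lceil m/2\rceil}\left[{n-\lceil m/2\rceil\atop \lfloor m/2\rfloor}\right]_{xy}}{(x;xy)_{\lceil m/2\rceil}\,(x^ny^{n-1};(xy)^{-1})_{\lfloor m/2\rfloor}}.$$ -/

import Mathlib

/-- Sequences `(λ₁, …, λ_k)` of nonnegative integers that are nonincreasing and satisfy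
`λ₁ / n ≥ λ₂ / (n - 1) ≥ ⋯ ≥ λ_k / (n - k + 1) ≥ 0` (used for `k ≤ n`).
The part `λ_{i+1}` is `l i`, for `i = 0, …, k - 1`. -/
def truncatedLectureHall (n k : ℕ) : Set (Fin k → ℕ) :=
  {l | Antitone l ∧
    ∀ i j : Fin k, (j : ℕ) = (i : ℕ) + 1 →
      (l j : ℚ) / ((n : ℚ) - (j : ℕ)) ≤ (l i : ℚ) / ((n : ℚ) - (i : ℕ))}

/-- The truncated lecture hall partitions `(λ₁, …, λ_k)` all of whose `k` parts are positive. -/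
def positiveTruncatedLectureHall (n k : ℕ) : Set (Fin k → ℕ) :=
  {l | l ∈ truncatedLectureHall n k ∧ ∀ i, 0 < l i}

/-- `|λ_o| = λ₁ + λ₃ + λ₅ + ⋯`; the index of `λ_{i+1}` is odd when `i` is even. -/
def oddWeight {k : ℕ} (l : Fin k → ℕ) : ℕ :=
  ∑ i : Fin k, if Even (i : ℕ) then l i else 0

/-- `|λ_e| = λ₂ + λ₄ + λ₆ + ⋯`. -/
def evenWeight {k : ℕ} (l : Fin k → ℕ) : ℕ :=
  ∑ i : Fin k, if Even (i : ℕ) then 0 else l i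

/-- Only finitely many sequences have given odd and even weights, so the cardinalities
in `oddEvenSeries` are those of finite sets. -/
theorem finite_oddWeight_evenWeight {k : ℕ} (S : Set (Fin k → ℕ)) (a b : ℕ) :
    {l | l ∈ S ∧ oddWeight l = a ∧ evenWeight l = b}.Finite := by
  refine (Set.finite_Iic (fun _ : Fin k => a + b)).subset ?_
  rintro l ⟨-, rfl, rfl⟩ i
  have h : oddWeight l + evenWeight l = ∑ i : Fin k, l i := by
    unfold oddWeight evenWeight
    rw [← Finset.sum_add_distrib]
    refine Finset.sum_congr rfl fun i _ => ?_
    split_ifs <;> simp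
  show l i ≤ oddWeight l + evenWeight l
  rw [h]
  exact Finset.single_le_sum (f := l) (fun _ _ => Nat.zero_le _) (Finset.mem_univ i)

/-- The formal power series `∑_{λ ∈ S} x^{|λ_o|} y^{|λ_e|}` in `ℤ⟦x, y⟧`, where `x` and `y` are the
variables with index `0` and `1`: the coefficient of `x^a y^b` is the number of `λ ∈ S` with
`|λ_o| = a` and `|λ_e| = b`. -/
noncomputable def oddEvenSeries {k : ℕ} (S : Set (Fin k → ℕ)) : MvPowerSeries (Fin 2) ℤ :=
  fun d => (({l | l ∈ S ∧ oddWeight l = d 0 ∧ evenWeight l = d 1}.ncard : ℕ) : ℤ)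

/-- The fraction field of `ℤ⟦x, y⟧`, into which `ℤ⟦x, y⟧` embeds. -/
abbrev SeriesField : Type := FractionRing (MvPowerSeries (Fin 2) ℤ)

/-- The variable `x`, as an element of the fraction field of `ℤ⟦x, y⟧`. -/
noncomputable def varX : SeriesField :=
  algebraMap (MvPowerSeries (Fin 2) ℤ) SeriesField (MvPowerSeries.X 0)

/-- The variable `y`, as an element of the fraction field of `ℤ⟦x, y⟧`. -/
noncomputable def varY : SeriesField :=
  algebraMap (MvPowerSeries (Fin 2) ℤ) SeriesField (MvPowerSeries.X 1)

/-- `∑_{λ ∈ S} x^{|λ_o|} y^{|λ_e|}`, as an element of the fraction field of `ℤ⟦x, y⟧`. -/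
noncomputable def oddEvenGF {k : ℕ} (S : Set (Fin k → ℕ)) : SeriesField :=
  algebraMap (MvPowerSeries (Fin 2) ℤ) SeriesField (oddEvenSeries S)

/-- `(a; q)_n = ∏_{i=0}^{n-1} (1 - a q^i)`. -/
def qPoch {F : Type*} [Field F] (a q : F) (n : ℕ) : F :=
  ∏ i ∈ Finset.range n, (1 - a * q ^ i)

/-- The Gaussian polynomial `(q^{n-m+1}; q)_m / (q; q)_m`. -/
def gaussBinom {F : Type*} [Field F] (q : F) (n m : ℕ) : F :=
  qPoch (q ^ ((n : ℤ) - (m : ℤ) + 1)) q m / qPoch q q m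

/-! Remove the largest part `a` of a partition with parameter `n + 1`: the odd and even weights
trade places, and the remaining partition, with largest part `b` and parameter `n`, is subject only
to `ceilUp n b ≤ a`. Summing over `a` is a geometric series, so `1 - x` times the series for `n + 1`
is the sum over the shorter partitions, with weights `(y, x)`, of the extra factor `x ^ ceilUp n b`.

This factor is absorbed by a reflection. Between fixed neighbours, each second part of the shorter
partition runs over an interval from a `ceilUp` to a `floorDown`, and is replaced by its mirror
image. Because `ceilUp n b + floorDown n b = 2 * b`, the weights `(y, x)` become `(x²y, x⁻¹)`. Only
the end of the partition leaves a trace: a factor `x` if the number of remaining parts is even, and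
a second term with one more part if it is odd (`headPoly_reflect_even`, `headPoly_reflect_odd`).

With `q = xy`, the weights are `(z, q/z)` with `z = x`, and the reflection turns them into `(zq,
q/(zq))`. Hence the family `z = x q^r` is closed under the step and satisfies two recurrences in
`n`, one for each parity. The products satisfy the same recurrences, so the two agree by induction
on `n`. Allowing zero parts amounts to summing over the number of positive parts. -/

/-! ### Rounding in the lecture hall inequalities -/

/-- The least `c` with `b / n ≤ c / (n + 1)`. -/
def ceilUp (n b : ℕ) : ℕ := b + (b + n - 1) / n

/-- The largest `b` with `b / (n - 1) ≤ a / n`. -/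
def floorDown (n a : ℕ) : ℕ := a - (a + n - 1) / n

theorem ceil_div_le_iff {n : ℕ} (hn : 0 < n) (b d : ℕ) : (b + n - 1) / n ≤ d ↔ b ≤ d * n := by
  rw [← Nat.lt_succ_iff, Nat.div_lt_iff_lt_mul hn, Nat.succ_mul]
  omega

theorem ceilUp_le_iff {n : ℕ} (hn : 0 < n) (b c : ℕ) :
    ceilUp n b ≤ c ↔ b * (n + 1) ≤ c * n := by
  have key := ceil_div_le_iff hn b
  unfold ceilUp
  generalize (b + n - 1) / n = e at key ⊢
  constructor
  · intro h
    obtain ⟨d, rfl⟩ := Nat.exists_eq_add_of_le (le_of_add_le_left h)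
    have := (key d).1 (by omega)
    nlinarith
  · intro h
    have h2 : b ≤ c := by nlinarith
    obtain ⟨d, rfl⟩ := Nat.exists_eq_add_of_le h2
    have := (key d).2 (by nlinarith)
    omega

theorem le_floorDown_iff (n b c : ℕ) :
    b ≤ floorDown (n + 1) c ↔ b * (n + 1) ≤ c * n := by
  have key := ceil_div_le_iff (Nat.succ_pos n) c
  have hc := (key c).2 (by nlinarith)
  unfold floorDown
  simp only [Nat.succ_eq_add_one] at key hc
  generalize (c + (n + 1) - 1) / (n + 1) = e at key hc ⊢
  constructor
  · intro h
    have h2 : b ≤ c := by omega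
    obtain ⟨d, rfl⟩ := Nat.exists_eq_add_of_le h2
    have := (key d).1 (by omega)
    nlinarith
  · intro h
    have h2 : b ≤ c := by nlinarith
    obtain ⟨d, rfl⟩ := Nat.exists_eq_add_of_le h2
    have := (key d).2 (by nlinarith)
    omega

/-- Each bound on one neighbour given the other is the same cross-multiplied inequality; this
adjunction is what permits exchanging the order of summation over adjacent parts. -/
theorem ceilUp_le_iff_le_floorDown {n : ℕ} (hn : 0 < n) (b c : ℕ) :
    ceilUp n b ≤ c ↔ b ≤ floorDown (n + 1) c := by
  rw [ceilUp_le_iff hn, le_floorDown_iff]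

/-- The two roundings differ from `b` by the same amount `⌈b/n⌉`, in opposite directions. This
symmetry makes the reflection work. -/
theorem ceilUp_add_floorDown {n : ℕ} (hn : 0 < n) (b : ℕ) :
    ceilUp n b + floorDown n b = 2 * b := by
  have hb := (ceil_div_le_iff hn b b).2 (by nlinarith)
  unfold ceilUp floorDown
  generalize (b + n - 1) / n = e at hb ⊢
  omega

theorem floorDown_le (n a : ℕ) : floorDown n a ≤ a := Nat.sub_le _ _

theorem le_ceilUp (n b : ℕ) : b ≤ ceilUp n b := Nat.le_add_right _ _

theorem floorDown_one (a : ℕ) : floorDown 1 a = 0 := by simp [floorDown]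

theorem floorDown_zero {n : ℕ} : floorDown n 0 = 0 := by simp [floorDown]

theorem ceilUp_strictMono (n : ℕ) : StrictMono (ceilUp n) := fun a b h =>
  add_lt_add_of_lt_of_le h (Nat.div_le_div_right (by omega))

theorem ceilUp_zero (n : ℕ) : ceilUp n 0 = 0 := by
  rcases n with _ | n <;> simp [ceilUp]

/-- Raising `c` by one enlarges the range `{b | ceilUp n b ≤ c}` by the solution of
`ceilUp n b = c + 1`, if there is one. -/
theorem sum_Icc_floorDown_succ {M : Type*} [AddCommMonoid M] {n : ℕ} (hn : 0 < n) (h : ℕ → M)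
    (c : ℕ) :
    ∑ b ∈ Finset.Icc 1 (floorDown (n + 1) (c + 1)), h b =
      ∑ b ∈ Finset.Icc 1 (floorDown (n + 1) c), h b +
        Function.extend (ceilUp n) h 0 (c + 1) := by
  have h1 := ceilUp_le_iff_le_floorDown hn
  have hmono : floorDown (n + 1) c ≤ floorDown (n + 1) (c + 1) := by
    rw [← h1]
    exact ((h1 _ _).2 le_rfl).trans (Nat.le_succ c)
  by_cases hc : ∃ b, ceilUp n b = c + 1
  · obtain ⟨b, hb⟩ := hc
    have hb1 : b ≤ floorDown (n + 1) (c + 1) := (h1 _ _).1 hb.le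
    have hb2 : ¬ b ≤ floorDown (n + 1) c := by
      rw [← h1]
      omega
    have hb3 : ¬ b < floorDown (n + 1) (c + 1) := by
      intro hlt
      have := (h1 _ _).2 (Nat.succ_le_of_lt hlt)
      have := ceilUp_strictMono n (Nat.lt_succ_self b)
      omega
    have hb4 : ¬ floorDown (n + 1) c + 1 < b := by
      intro hlt
      have h3 : ¬ ceilUp n (floorDown (n + 1) c + 1) ≤ c := by
        rw [h1]
        omega
      have := ceilUp_strictMono n hlt
      omega
    have e1 : floorDown (n + 1) (c + 1) = b := by omega
    have e2 : b = floorDown (n + 1) c + 1 := by omega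
    rw [← hb, (ceilUp_strictMono n).injective.extend_apply, hb, e1, e2,
      Finset.sum_Icc_succ_top (by omega)]
  · have e : floorDown (n + 1) (c + 1) = floorDown (n + 1) c := by
      refine le_antisymm ?_ hmono
      rw [← h1]
      have h2 := (h1 _ _).2 (le_refl (floorDown (n + 1) (c + 1)))
      have h3 : ceilUp n (floorDown (n + 1) (c + 1)) ≠ c + 1 := fun h => hc ⟨_, h⟩
      omega
    rw [Function.extend_apply' _ _ _ hc, e]
    simp

/-! ### Partitions sorted by largest part -/

/-- The truncated lecture hall partitions with `k + 1` positive parts and largest part `a`. -/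
def lectureHallHead : (n k a : ℕ) → Finset (Fin (k + 1) → ℕ)
  | _, 0, a => if 0 < a then {fun _ => a} else ∅
  | n, k + 1, a =>
    (Finset.Icc 1 (floorDown n a)).biUnion fun b =>
      (lectureHallHead (n - 1) k b).image fun t => (Fin.cons a t : Fin (k + 2) → ℕ)

theorem oddWeight_cons {k : ℕ} (a : ℕ) (t : Fin k → ℕ) :
    oddWeight (Fin.cons a t : Fin (k + 1) → ℕ) = a + evenWeight t := by
  unfold oddWeight evenWeight
  rw [Fin.sum_univ_succ]
  simp only [Fin.cons_zero, Fin.cons_succ, Fin.val_zero, Fin.val_succ, Nat.even_add_one, ite_not]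
  simp

theorem evenWeight_cons {k : ℕ} (a : ℕ) (t : Fin k → ℕ) :
    evenWeight (Fin.cons a t : Fin (k + 1) → ℕ) = oddWeight t := by
  unfold oddWeight evenWeight
  rw [Fin.sum_univ_succ]
  simp only [Fin.cons_zero, Fin.cons_succ, Fin.val_zero, Fin.val_succ, Nat.even_add_one, ite_not]
  simp

theorem head_of_mem_lectureHallHead {n k a : ℕ} {l : Fin (k + 1) → ℕ}
    (h : l ∈ lectureHallHead n k a) : l 0 = a := by
  cases k with
  | zero =>
    simp only [lectureHallHead] at h
    split_ifs at h
    · simp only [Finset.mem_singleton] at h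
      rw [h]
    · simp at h
  | succ k =>
    simp only [lectureHallHead, Finset.mem_biUnion, Finset.mem_image] at h
    obtain ⟨b, -, t, -, rfl⟩ := h
    rfl

/-- Ensures that `x^o y^e = z^(o - e) q^e` has natural exponents even when the weight `q/z` of the
even parts is not a power series, and that the largest part is bounded by the odd weight. -/
theorem weights_of_mem_lectureHallHead {n k a : ℕ} {l : Fin (k + 1) → ℕ}
    (h : l ∈ lectureHallHead n k a) :
    evenWeight l ≤ oddWeight l ∧ oddWeight l ≤ evenWeight l + a ∧ a ≤ oddWeight l := by
  induction k generalizing n a with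
  | zero =>
    simp only [lectureHallHead] at h
    split_ifs at h
    · simp only [Finset.mem_singleton] at h
      rw [h]
      simp [oddWeight, evenWeight]
    · simp at h
  | succ k ih =>
    simp only [lectureHallHead, Finset.mem_biUnion, Finset.mem_image, Finset.mem_Icc] at h
    obtain ⟨b, hb, t, ht, rfl⟩ := h
    have := ih ht
    have := floorDown_le n a
    rw [oddWeight_cons, evenWeight_cons]
    omega

/-- `∑ x^{|λ_o|} y^{|λ_e|}` over the truncated lecture hall partitions with `k + 1` positive parts
and largest part `a`. -/
def headPoly {A : Type*} [CommSemiring A] (n k a : ℕ) (x y : A) : A :=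
  ∑ l ∈ lectureHallHead n k a, x ^ oddWeight l * y ^ evenWeight l

theorem headPoly_zero {A : Type*} [CommSemiring A] (n : ℕ) {a : ℕ} (ha : 0 < a) (x y : A) :
    headPoly n 0 a x y = x ^ a := by
  simp [headPoly, lectureHallHead, ha, oddWeight, evenWeight]

theorem lectureHallHead_head_zero (n k : ℕ) : lectureHallHead n k 0 = ∅ := by
  cases k <;> simp [lectureHallHead, floorDown_zero]

theorem headPoly_succ {A : Type*} [CommSemiring A] (n k a : ℕ) (x y : A) :
    headPoly n (k + 1) a x y =
      x ^ a * ∑ b ∈ Finset.Icc 1 (floorDown n a), headPoly (n - 1) k b y x := by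
  unfold headPoly
  rw [lectureHallHead, Finset.sum_biUnion, Finset.mul_sum]
  · refine Finset.sum_congr rfl fun b _ => ?_
    rw [Finset.sum_image (fun s _ t _ h => Fin.cons_right_injective (α := fun _ => ℕ) a h),
      Finset.mul_sum]
    refine Finset.sum_congr rfl fun t _ => ?_
    rw [oddWeight_cons, evenWeight_cons]
    ring
  · intro b _ c _ hbc
    rw [Function.onFun, Finset.disjoint_left]
    intro l hl hl'
    simp only [Finset.mem_image] at hl hl'
    obtain ⟨s, hs, rfl⟩ := hl
    obtain ⟨t, ht, hst⟩ := hl'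
    have := Fin.cons_right_injective (α := fun _ => ℕ) a hst
    subst this
    exact hbc ((head_of_mem_lectureHallHead hs).symm.trans (head_of_mem_lectureHallHead ht))

/-- The recursion descends to parameter `1`, where `floorDown 1` is `0` and leaves no room for a
further positive part. -/
theorem lectureHallHead_eq_empty {n : ℕ} (hn : 0 < n) (a : ℕ) : lectureHallHead n n a = ∅ := by
  induction n generalizing a with
  | zero => omega
  | succ n ih =>
    rcases Nat.eq_zero_or_pos n with rfl | h
    · simp [lectureHallHead, floorDown_one]
    · ext l
      simp [lectureHallHead, ih h]

theorem lectureHall_cons_iff {n k a : ℕ} (hk : k ≤ n) {t : Fin k → ℕ} :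
    (Fin.cons a t : Fin (k + 1) → ℕ) ∈ positiveTruncatedLectureHall (n + 1) (k + 1) ↔
      0 < a ∧ t ∈ positiveTruncatedLectureHall n k ∧
        ∀ h : 0 < k, t ⟨0, h⟩ ≤ floorDown (n + 1) a := by
  have key : ∀ h : 0 < k, (t ⟨0, h⟩ ≤ floorDown (n + 1) a ↔
      (t ⟨0, h⟩ : ℚ) / (n : ℚ) ≤ (a : ℚ) / ((n : ℚ) + 1)) := by
    intro h
    have hn : 0 < (n : ℚ) := by exact_mod_cast (by omega : 0 < n)
    rw [le_floorDown_iff, div_le_div_iff₀ hn (by positivity)]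
    exact_mod_cast Iff.rfl
  constructor
  · rintro ⟨⟨h1, h2⟩, h3⟩
    refine ⟨by simpa using h3 0, ⟨⟨?_, ?_⟩, fun i => by simpa using h3 i.succ⟩, fun h => ?_⟩
    · intro i j hij
      simpa using h1 (Fin.succ_le_succ_iff.2 hij)
    · intro i j hij
      simpa using h2 i.succ j.succ (by simp [hij])
    · rw [key h]
      simpa [Fin.cons] using h2 0 (Fin.succ ⟨0, h⟩) (by simp)
  · rintro ⟨ha, ⟨⟨h1, h2⟩, h3⟩, h4⟩
    refine ⟨⟨?_, ?_⟩, fun i => ?_⟩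
    · intro i j hij
      induction i using Fin.cases with
      | zero =>
        induction j using Fin.cases with
        | zero => exact le_rfl
        | succ j =>
          have hk' : 0 < k := j.pos
          have := h1 (show (⟨0, hk'⟩ : Fin k) ≤ j from Nat.zero_le _)
          simpa using this.trans ((h4 hk').trans (floorDown_le _ _))
      | succ i =>
        induction j using Fin.cases with
        | zero => exact absurd hij (by simp)
        | succ j => simpa using h1 (Fin.succ_le_succ_iff.1 hij)
    · intro i j hij
      induction j using Fin.cases with
      | zero => simp at hij
      | succ j =>
        induction i using Fin.cases with
        | zero =>
          obtain ⟨j, hj⟩ := j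
          obtain rfl : j = 0 := by simpa using hij
          simpa [Fin.cons] using (key hj).1 (h4 hj)
        | succ i => simpa using h2 i j (by simpa using hij)
    · induction i using Fin.cases with
      | zero => simpa using ha
      | succ i => simpa using h3 i

theorem mem_lectureHallHead_iff {n k a : ℕ} (hk : k < n) {l : Fin (k + 1) → ℕ} :
    l ∈ lectureHallHead n k a ↔ l ∈ positiveTruncatedLectureHall n (k + 1) ∧ l 0 = a := by
  induction k generalizing n a with
  | zero =>
    obtain ⟨n, rfl⟩ : ∃ m, n = m + 1 := ⟨n - 1, by omega⟩
    induction l using Fin.consCases with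
    | cons b t =>
    rw [lectureHall_cons_iff (by omega)]
    have ht : t ∈ positiveTruncatedLectureHall n 0 :=
      ⟨⟨fun i => i.elim0, fun i => i.elim0⟩, fun i => i.elim0⟩
    simp only [lectureHallHead, ht, Fin.cons_zero]
    split_ifs with h
    · have e : (Fin.cons b t : Fin 1 → ℕ) = (fun _ => a) ↔ b = a :=
        ⟨fun h => congrFun h 0, fun h => funext fun i => by rw [Fin.fin_one_eq_zero i]; exact h⟩
      rw [Finset.mem_singleton, e]
      constructor
      · rintro rfl
        simpa using h
      · simp
    · simp
      omega
  | succ k ih =>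
    obtain ⟨n, rfl⟩ : ∃ m, n = m + 1 := ⟨n - 1, by omega⟩
    induction l using Fin.consCases with
    | cons c t =>
    rw [lectureHall_cons_iff (by omega)]
    simp only [lectureHallHead, Finset.mem_biUnion, Finset.mem_image, Finset.mem_Icc,
      Nat.add_sub_cancel, Fin.cons_zero, Fin.cons_inj]
    constructor
    · rintro ⟨b, ⟨hb, hb'⟩, s, hs, rfl, rfl⟩
      obtain ⟨hs1, hs2⟩ := (ih (by omega)).1 hs
      have := floorDown_le (n + 1) a
      refine ⟨⟨by omega, hs1, fun _ => ?_⟩, rfl⟩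
      exact hs2.le.trans hb'
    · rintro ⟨⟨h1, h2, h3⟩, rfl⟩
      exact ⟨t 0, ⟨h2.2 0, h3 (Nat.succ_pos k)⟩, t, (ih (by omega)).2 ⟨h2, rfl⟩, rfl, rfl⟩

theorem headPoly_head_zero {A : Type*} [CommSemiring A] (n k : ℕ) (x y : A) :
    headPoly n k 0 x y = 0 := by
  simp [headPoly, lectureHallHead_head_zero]

theorem headPoly_one {A : Type*} [CommSemiring A] (n a : ℕ) (x y : A) :
    headPoly n 1 a x y = x ^ a * ∑ c ∈ Finset.Icc 1 (floorDown n a), y ^ c := by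
  rw [headPoly_succ]
  refine congrArg _ (Finset.sum_congr rfl fun c hc => ?_)
  rw [headPoly_zero _ (Finset.mem_Icc.1 hc).1]

theorem headPoly_add_two {A : Type*} [CommSemiring A] (n k a : ℕ) (x y : A) :
    headPoly (n + 2) (k + 2) a x y =
      x ^ a * ∑ c ∈ Finset.Icc 1 (floorDown (n + 2) a),
        y ^ c * ∑ d ∈ Finset.Icc 1 (floorDown (n + 1) c), headPoly n k d x y := by
  rw [headPoly_succ]
  refine congrArg _ (Finset.sum_congr rfl fun c _ => ?_)
  rw [headPoly_succ]
  rfl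

/-! ### Reflection of every second part -/

section Reflection

variable {K : Type*} [Field K] {x : K}

theorem sum_pow_Icc_reflect (hx : x ≠ 0) (u D : ℕ) :
    ∑ c ∈ Finset.Icc u D, x ^ c = x ^ (u + D) * ∑ c ∈ Finset.Icc u D, x⁻¹ ^ c := by
  rw [Finset.mul_sum]
  refine Finset.sum_nbij' (fun c => u + D - c) (fun c => u + D - c) ?_ ?_ ?_ ?_ ?_
  · intro c hc
    rw [Finset.mem_Icc] at hc ⊢
    omega
  · intro c hc
    rw [Finset.mem_Icc] at hc ⊢
    omega
  · intro c hc
    rw [Finset.mem_Icc] at hc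
    omega
  · intro c hc
    rw [Finset.mem_Icc] at hc
    omega
  · intro c hc
    rw [Finset.mem_Icc] at hc
    obtain ⟨e, he⟩ : ∃ e, u + D = c + e := ⟨u + D - c, by omega⟩
    rw [he, Nat.add_sub_cancel_left, pow_add, inv_pow]
    field_simp

/-- Replacing every second part by its mirror image in its range carries the weights `(y, x)` to
`(x²y, x⁻¹)`, up to a power of `x` that depends on the largest part only. -/
theorem reflect_step (hx : x ≠ 0) (y : K) {m : ℕ} (hm : 0 < m) {f g : ℕ → K}
    (hfg : ∀ d, x ^ ceilUp m d * f d = g d) (b : ℕ) :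
    x ^ ceilUp (m + 2) b * (y ^ b * ∑ c ∈ Finset.Icc 1 (floorDown (m + 2) b),
        x ^ c * ∑ d ∈ Finset.Icc 1 (floorDown (m + 1) c), f d) =
      (x ^ 2 * y) ^ b * ∑ c ∈ Finset.Icc 1 (floorDown (m + 2) b),
        x⁻¹ ^ c * ∑ d ∈ Finset.Icc 1 (floorDown (m + 1) c), g d := by
  -- With `d` summed outermost, `c` runs over the whole interval from `ceilUp m d` to `D`, which can
  -- be reversed.
  have swap : ∀ (D : ℕ) (F : ℕ → ℕ → K),
      ∑ c ∈ Finset.Icc 1 D, ∑ d ∈ Finset.Icc 1 (floorDown (m + 1) c), F c d =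
        ∑ d ∈ Finset.Icc 1 D, ∑ c ∈ Finset.Icc (ceilUp m d) D, F c d := by
    intro D F
    refine Finset.sum_comm' fun c d => ?_
    simp only [Finset.mem_Icc]
    rw [← ceilUp_le_iff_le_floorDown hm]
    have := le_ceilUp m d
    omega
  have hb := ceilUp_add_floorDown (n := m + 2) (by omega) b
  simp only [Finset.mul_sum (Finset.Icc 1 (floorDown (m + 1) _)), swap]
  simp only [← Finset.sum_mul, sum_pow_Icc_reflect hx, ← hfg]
  rw [mul_pow, ← pow_mul, ← hb, pow_add]
  simp only [Finset.mul_sum (Finset.Icc 1 _), pow_add]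
  refine Finset.sum_congr rfl fun d _ => ?_
  ring

/-- The number of parts is even, so the last part is reflected; its interval starts at `1`, and this
lower end yields the single factor `x`. -/
theorem headPoly_reflect_even (hx : x ≠ 0) (y : K) {n i : ℕ} (hn : 2 * i + 1 < n) (b : ℕ) :
    x ^ ceilUp n b * headPoly n (2 * i + 1) b y x =
      x * headPoly n (2 * i + 1) b (x ^ 2 * y) x⁻¹ := by
  induction i generalizing n b with
  | zero =>
    have hb := ceilUp_add_floorDown (n := n) (by omega) b
    rw [headPoly_one, headPoly_one, sum_pow_Icc_reflect hx, mul_pow, ← pow_mul, ← hb]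
    ring
  | succ i ih =>
    obtain ⟨m, rfl⟩ : ∃ m, n = m + 2 := ⟨n - 2, by omega⟩
    have e : 2 * (i + 1) + 1 = 2 * i + 1 + 2 := by ring
    rw [e, headPoly_add_two, headPoly_add_two,
      reflect_step hx y (by omega) (fun d => ih (by omega) d)]
    simp only [Finset.mul_sum]
    refine Finset.sum_congr rfl fun c _ => Finset.sum_congr rfl fun d _ => ?_
    ring

/-- The last part is not reflected, so a power `x⁻¹ ^ D` remains, where `D` is the bound for one
more part. Writing it as `1 + (1 - x) ∑ x⁻¹ ^ c` over `1 ≤ c ≤ D`, the first term keeps the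
partition and the sum appends a part `c`. -/
theorem headPoly_reflect_odd (hx : x ≠ 0) (y : K) {n i : ℕ} (hn : 2 * i < n) (b : ℕ) :
    x ^ ceilUp n b * headPoly n (2 * i) b y x =
      headPoly n (2 * i) b (x ^ 2 * y) x⁻¹ +
        (1 - x) * headPoly n (2 * i + 1) b (x ^ 2 * y) x⁻¹ := by
  induction i generalizing n b with
  | zero =>
    rcases Nat.eq_zero_or_pos b with rfl | hb0
    · simp [headPoly_head_zero]
    have hb := ceilUp_add_floorDown (n := n) (by omega) b
    -- Telescoping: `(1 - x) x⁻¹ ^ c = x⁻¹ ^ c - x⁻¹ ^ (c - 1)`.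
    have geom : ∀ D : ℕ, (1 - x) * ∑ c ∈ Finset.Icc 1 D, x⁻¹ ^ c = x⁻¹ ^ D - 1 := by
      intro D
      induction D with
      | zero => simp
      | succ D ih =>
        rw [Finset.sum_Icc_succ_top (by omega), mul_add, ih, pow_succ]
        field_simp
        ring
    rw [mul_zero, zero_add, headPoly_one, headPoly_zero _ hb0, headPoly_zero _ hb0,
      mul_left_comm, geom, mul_pow, ← pow_mul, ← hb, pow_add, inv_pow]
    field_simp
    ring
  | succ i ih =>
    obtain ⟨m, rfl⟩ : ∃ m, n = m + 2 := ⟨n - 2, by omega⟩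
    have e : 2 * (i + 1) = 2 * i + 2 := by ring
    have e' : 2 * (i + 1) + 1 = 2 * i + 1 + 2 := by ring
    rw [e', e, headPoly_add_two, headPoly_add_two, headPoly_add_two,
      reflect_step hx y (by omega) (fun d => ih (by omega) d)]
    simp only [Finset.mul_sum, ← Finset.sum_add_distrib]
    refine Finset.sum_congr rfl fun c _ => Finset.sum_congr rfl fun d _ => ?_
    ring

/-- The partitions with largest part `c + 1` are those with largest part `c`, with one unit added,
and those whose largest part is the least that the second part admits. -/
theorem headPoly_succ_head {n : ℕ} (hn : 0 < n) (k : ℕ) (x y : K) {h : ℕ → K}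
    (hh : ∀ b, x ^ ceilUp n b * headPoly n k b y x = h b) (c : ℕ) :
    headPoly (n + 1) (k + 1) (c + 1) x y =
      x * headPoly (n + 1) (k + 1) c x y + Function.extend (ceilUp n) h 0 (c + 1) := by
  rw [headPoly_succ, headPoly_succ, sum_Icc_floorDown_succ hn, Nat.add_sub_cancel, mul_add,
    pow_succ']
  congr 1
  · ring
  · by_cases hc : ∃ b, ceilUp n b = c + 1
    · obtain ⟨b, hb⟩ := hc
      rw [← hb, (ceilUp_strictMono n).injective.extend_apply,
        (ceilUp_strictMono n).injective.extend_apply, ← hh, hb, pow_succ']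
    · rw [Function.extend_apply' _ _ _ hc, Function.extend_apply' _ _ _ hc]
      simp

end Reflection

/-! ### Recurrences for the power series -/

open scoped MvPowerSeries.WithPiTopology in
theorem tsum_of_succ_eq {f e : ℕ → MvPowerSeries (Fin 2) ℤ} {z : MvPowerSeries (Fin 2) ℤ}
    (hf : Summable f) (he : Summable e) (hf0 : f 0 = 0) (he0 : e 0 = 0)
    (h : ∀ c, f (c + 1) = z * f c + e (c + 1)) :
    (1 - z) * ∑' c, f c = ∑' c, e c := by
  have h1 : ∑' c, f c = ∑' c, f (c + 1) := by rw [hf.tsum_eq_zero_add, hf0, zero_add]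
  have h2 : ∑' c, e c = ∑' c, e (c + 1) := by rw [he.tsum_eq_zero_add, he0, zero_add]
  have h3 : ∑' c, f (c + 1) = z * ∑' c, f c + ∑' c, e (c + 1) := by
    simp only [h]
    rw [((hf.mul_left z)).tsum_add ((summable_nat_add_iff 1).2 he), hf.tsum_mul_left]
  rw [h2]
  linear_combination h1 + h3

/-- The product `xy` in `ℤ⟦x, y⟧`. -/
noncomputable def qSeries : MvPowerSeries (Fin 2) ℤ := MvPowerSeries.X 0 * MvPowerSeries.X 1

/-- The monomial `x (xy)^r` in `ℤ⟦x, y⟧`. -/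
noncomputable def zSeries (r : ℕ) : MvPowerSeries (Fin 2) ℤ := MvPowerSeries.X 0 * qSeries ^ r

theorem zSeries_pow_mul_qSeries_pow (r i e : ℕ) :
    zSeries r ^ i * qSeries ^ e = MvPowerSeries.monomial
      (Finsupp.single 0 (i * (r + 1) + e) + Finsupp.single 1 (i * r + e)) (1 : ℤ) := by
  rw [← mul_one (1 : ℤ), ← MvPowerSeries.monomial_mul_monomial, ← MvPowerSeries.X_pow_eq,
    ← MvPowerSeries.X_pow_eq, zSeries, qSeries]
  ring

/-- The terms of the series with largest part `a`; the weights are `x (xy)^r` for the odd parts and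
`x⁻¹ (xy)^(1 - r)` for the even parts. -/
noncomputable def headSeries (r n k a : ℕ) : MvPowerSeries (Fin 2) ℤ :=
  ∑ l ∈ lectureHallHead n k a, zSeries r ^ (oddWeight l - evenWeight l) * qSeries ^ evenWeight l

theorem coeff_headSeries (r n k a : ℕ) (d : Fin 2 →₀ ℕ) :
    MvPowerSeries.coeff d (headSeries r n k a) =
      ((lectureHallHead n k a).filter fun l =>
        d 0 = (oddWeight l - evenWeight l) * (r + 1) + evenWeight l ∧
        d 1 = (oddWeight l - evenWeight l) * r + evenWeight l).card := by
  rw [headSeries, map_sum, Finset.card_filter, Nat.cast_sum]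
  refine Finset.sum_congr rfl fun l _ => ?_
  rw [zSeries_pow_mul_qSeries_pow, MvPowerSeries.coeff_monomial]
  have : ∀ u v : ℕ, d = Finsupp.single 0 u + Finsupp.single 1 v ↔ d 0 = u ∧ d 1 = v := by
    intro u v
    simp [Finsupp.ext_iff]
  simp only [this, Nat.cast_ite, Nat.cast_one, Nat.cast_zero]

/-- The exponent of `X 0` in a term is at least its odd weight, hence at least `a`; so each
coefficient sees finitely many `a`. -/
theorem coeff_headSeries_eq_zero (r n k : ℕ) {a : ℕ} {d : Fin 2 →₀ ℕ} (h : d 0 < a) :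
    MvPowerSeries.coeff d (headSeries r n k a) = 0 := by
  rw [coeff_headSeries, Nat.cast_eq_zero, Finset.card_eq_zero, Finset.filter_eq_empty_iff]
  rintro l hl ⟨h0, -⟩
  have := weights_of_mem_lectureHallHead hl
  have : (oddWeight l - evenWeight l) ≤ (oddWeight l - evenWeight l) * (r + 1) := by nlinarith
  omega

theorem headSeries_zero (r n k : ℕ) : headSeries r n k 0 = 0 := by
  simp [headSeries, lectureHallHead_head_zero]

open scoped MvPowerSeries.WithPiTopology in
theorem summable_headSeries (r n k : ℕ) : Summable (headSeries r n k) := by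
  rw [MvPowerSeries.WithPiTopology.summable_iff_summable_coeff]
  intro d
  refine summable_of_ne_finset_zero (s := Finset.range (d 0 + 1)) fun a ha => ?_
  exact coeff_headSeries_eq_zero r n k (by simpa using ha)

open scoped MvPowerSeries.WithPiTopology in
/-- The series of the truncated lecture hall partitions with `k + 1` positive parts, with weights
`x (xy)^r` for the odd parts and `x⁻¹ (xy)^(1 - r)` for the even parts. -/
noncomputable def lectureSeries (r n k : ℕ) : MvPowerSeries (Fin 2) ℤ := ∑' a, headSeries r n k a

theorem oddEvenSeries_eq_lectureSeries {n k : ℕ} (hk : k < n) :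
    oddEvenSeries (positiveTruncatedLectureHall n (k + 1)) = lectureSeries 0 n k := by
  open scoped MvPowerSeries.WithPiTopology in
  refine (HasSum.tsum_eq ?_).symm
  rw [MvPowerSeries.WithPiTopology.hasSum_iff_hasSum_coeff]
  intro d
  have hfin := finite_oddWeight_evenWeight (positiveTruncatedLectureHall n (k + 1)) (d 0) (d 1)
  have e : MvPowerSeries.coeff d (oddEvenSeries (positiveTruncatedLectureHall n (k + 1))) =
      ∑ a ∈ Finset.range (d 0 + 1), MvPowerSeries.coeff d (headSeries 0 n k a) := by
    change ((Set.ncard _ : ℕ) : ℤ) = _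
    simp only [coeff_headSeries]
    rw [← Nat.cast_sum, Nat.cast_inj, Set.ncard_eq_toFinset_card _ hfin,
      Finset.card_eq_sum_card_fiberwise (f := fun l => l 0) (t := Finset.range (d 0 + 1))]
    · refine Finset.sum_congr rfl fun a _ => congrArg Finset.card ?_
      ext l
      simp only [Finset.mem_filter, Set.Finite.mem_toFinset, Set.mem_ofPred_eq,
        mem_lectureHallHead_iff hk]
      constructor
      · rintro ⟨⟨h1, h2, h3⟩, h4⟩
        have := weights_of_mem_lectureHallHead ((mem_lectureHallHead_iff hk).2 ⟨h1, h4⟩)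
        exact ⟨⟨h1, h4⟩, by omega, by omega⟩
      · rintro ⟨⟨h1, h4⟩, h2, h3⟩
        have := weights_of_mem_lectureHallHead ((mem_lectureHallHead_iff hk).2 ⟨h1, h4⟩)
        exact ⟨⟨h1, by omega, by omega⟩, h4⟩
    · intro l hl
      simp only [Set.Finite.coe_toFinset, Set.mem_ofPred_eq] at hl
      have := weights_of_mem_lectureHallHead ((mem_lectureHallHead_iff hk).2 ⟨hl.1, rfl⟩)
      simp only [Finset.coe_range, Set.mem_Iio]
      omega
  rw [e]
  exact hasSum_sum_of_ne_finset_zero fun a ha =>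
    coeff_headSeries_eq_zero 0 n k (by simpa using ha)

/-- The element `x (xy)^r` of the fraction field. -/
noncomputable def zField (r : ℕ) : SeriesField := varX * (varX * varY) ^ r

theorem algebraMap_zSeries (r : ℕ) : algebraMap _ SeriesField (zSeries r) = zField r := by
  simp [zSeries, zField, qSeries, varX, varY]

theorem algebraMap_seriesField_injective :
    Function.Injective (algebraMap (MvPowerSeries (Fin 2) ℤ) SeriesField) :=
  IsFractionRing.injective _ _

theorem varX_ne_zero : varX ≠ 0 := by
  unfold varX
  rw [map_ne_zero_iff _ algebraMap_seriesField_injective]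
  exact fun h => by simpa using congrArg (MvPowerSeries.coeff (Finsupp.single 0 1)) h

theorem varY_ne_zero : varY ≠ 0 := by
  unfold varY
  rw [map_ne_zero_iff _ algebraMap_seriesField_injective]
  exact fun h => by simpa using congrArg (MvPowerSeries.coeff (Finsupp.single 1 1)) h

theorem zField_ne_zero (r : ℕ) : zField r ≠ 0 :=
  mul_ne_zero varX_ne_zero (pow_ne_zero _ (mul_ne_zero varX_ne_zero varY_ne_zero))

theorem algebraMap_headSeries (r n k a : ℕ) :
    algebraMap _ SeriesField (headSeries r n k a) =
      headPoly n k a (zField r) (varX * varY / zField r) := by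
  rw [headSeries, headPoly, map_sum]
  refine Finset.sum_congr rfl fun l hl => ?_
  obtain ⟨i, hi⟩ := Nat.exists_eq_add_of_le (weights_of_mem_lectureHallHead hl).1
  have hz := zField_ne_zero r
  rw [map_mul, map_pow, map_pow, algebraMap_zSeries, hi, Nat.add_sub_cancel_left]
  have : algebraMap _ SeriesField qSeries = varX * varY := by simp [qSeries, varX, varY]
  rw [this, pow_add, div_pow]
  field_simp

/-- With `z = zField r` and `q = xy`, the reflected weights are `z² (q/z) = zq` and `z⁻¹ = q/(zq)`:
the reflection raises `r` by one. -/
theorem algebraMap_headSeries_succ (r n k a : ℕ) :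
    algebraMap _ SeriesField (headSeries (r + 1) n k a) =
      headPoly n k a (zField r ^ 2 * (varX * varY / zField r)) (zField r)⁻¹ := by
  have hx := varX_ne_zero
  have hy := varY_ne_zero
  have hz := zField_ne_zero r
  have h : zField (r + 1) = zField r * (varX * varY) := by
    simp only [zField]
    ring
  rw [algebraMap_headSeries, h]
  congr 1 <;> field_simp

/-- If the series `h` describes the partitions with least possible largest part, it determines
the series of all partitions. -/
theorem one_sub_mul_lectureSeries {r n k : ℕ} (hn : 0 < n) {h : ℕ → MvPowerSeries (Fin 2) ℤ}
    (hh : ∀ b, zField r ^ ceilUp n b * headPoly n k b (varX * varY / zField r) (zField r) =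
      algebraMap _ SeriesField (h b))
    (hh0 : h 0 = 0) {s : MvPowerSeries (Fin 2) ℤ}
    (hs : open scoped MvPowerSeries.WithPiTopology in HasSum h s) :
    (1 - zSeries r) * lectureSeries r (n + 1) (k + 1) = s := by
  open scoped MvPowerSeries.WithPiTopology in
  have hinj := (ceilUp_strictMono n).injective
  have hext := (hasSum_extend_zero hinj).2 hs
  rw [← hext.tsum_eq]
  refine tsum_of_succ_eq (summable_headSeries r (n + 1) (k + 1)) hext.summable
    (headSeries_zero _ _ _) ?_ fun c => algebraMap_seriesField_injective ?_
  · rw [← ceilUp_zero n, hinj.extend_apply, hh0]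
  · rw [map_add, map_mul, algebraMap_headSeries, algebraMap_headSeries, algebraMap_zSeries,
      headPoly_succ_head hn k _ _ hh]
    congr 1
    by_cases hc : ∃ b, ceilUp n b = c + 1
    · obtain ⟨b, hb⟩ := hc
      rw [← hb, hinj.extend_apply, hinj.extend_apply]
    · rw [Function.extend_apply' _ _ _ hc, Function.extend_apply' _ _ _ hc]
      simp

theorem one_sub_mul_lectureSeries_even (r : ℕ) {n i : ℕ} (hn : 2 * i + 1 < n) :
    (1 - zSeries r) * lectureSeries r (n + 1) (2 * i + 2) =
      zSeries r * lectureSeries (r + 1) n (2 * i + 1) := by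
  open scoped MvPowerSeries.WithPiTopology in
  refine one_sub_mul_lectureSeries (h := fun b => zSeries r * headSeries (r + 1) n (2 * i + 1) b)
    (by omega) (fun b => ?_) ?_ ((summable_headSeries _ _ _).hasSum.mul_left _)
  · rw [headPoly_reflect_even (zField_ne_zero r) _ hn, map_mul, algebraMap_zSeries,
      algebraMap_headSeries_succ]
  · simp [headSeries_zero]

theorem one_sub_mul_lectureSeries_odd (r : ℕ) {n i : ℕ} (hn : 2 * i < n) :
    (1 - zSeries r) * lectureSeries r (n + 1) (2 * i + 1) =
      lectureSeries (r + 1) n (2 * i) +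
        (1 - zSeries r) * lectureSeries (r + 1) n (2 * i + 1) := by
  open scoped MvPowerSeries.WithPiTopology in
  refine one_sub_mul_lectureSeries
    (h := fun b => headSeries (r + 1) n (2 * i) b +
      (1 - zSeries r) * headSeries (r + 1) n (2 * i + 1) b)
    (by omega) (fun b => ?_) ?_
    ((summable_headSeries _ _ _).hasSum.add ((summable_headSeries _ _ _).hasSum.mul_left _))
  · rw [headPoly_reflect_odd (zField_ne_zero r) _ hn, map_add, map_mul, map_sub, map_one,
      algebraMap_zSeries, algebraMap_headSeries_succ, algebraMap_headSeries_succ]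
  · simp [headSeries_zero]

theorem one_sub_mul_lectureSeries_zero (r n : ℕ) :
    (1 - zSeries r) * lectureSeries r n 0 = zSeries r := by
  open scoped MvPowerSeries.WithPiTopology in
  -- With a single part, only the part `1` does not arise by adding a unit to a smaller positive
  -- part.
  have hs : HasSum (Pi.single 1 (zSeries r) : ℕ → MvPowerSeries (Fin 2) ℤ) (zSeries r) :=
    hasSum_pi_single 1 (zSeries r)
  refine (tsum_of_succ_eq (summable_headSeries r n 0) hs.summable (headSeries_zero _ _ _)
    (by simp) fun c => ?_).trans hs.tsum_eq
  have key : ∀ c, headSeries r n 0 (c + 1) = zSeries r ^ (c + 1) := by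
    intro c
    simp [headSeries, lectureHallHead, oddWeight, evenWeight]
  rcases c with _ | c
  · rw [key, headSeries_zero]
    simp
  · rw [key, key, Pi.single_eq_of_ne (by omega), pow_succ']
    simp

theorem lectureSeries_self (r : ℕ) {n : ℕ} (hn : 0 < n) : lectureSeries r n n = 0 := by
  simp [lectureSeries, headSeries, lectureHallHead_eq_empty hn]

/-! ### The same recurrences for the products -/

section ProductFormula

variable {F : Type*} [Field F]

theorem qPoch_succ (a q : F) (m : ℕ) : qPoch a q (m + 1) = qPoch a q m * (1 - a * q ^ m) :=
  Finset.prod_range_succ _ _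

theorem qPoch_succ' (a q : F) (m : ℕ) : qPoch a q (m + 1) = (1 - a) * qPoch (a * q) q m := by
  unfold qPoch
  rw [Finset.prod_range_succ', mul_comm]
  simp [pow_succ', mul_assoc]

/-- The product side of the theorem for `k` parts, with `z` for `x` and `q` for `xy`. -/
def lectureProduct (q z : F) (n k : ℕ) : F :=
  (z * q ^ (k / 2)) ^ ((k + 1) / 2) * gaussBinom q (n - (k + 1) / 2) (k / 2) /
    (qPoch z q ((k + 1) / 2) * qPoch (z * q ^ ((n : ℤ) - 1)) q⁻¹ (k / 2))

theorem lectureProduct_odd (q z : F) (n i : ℕ) :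
    lectureProduct q z n (2 * i + 1) =
      (z * q ^ i) ^ (i + 1) * gaussBinom q (n - (i + 1)) i /
        (qPoch z q (i + 1) * qPoch (z * q ^ ((n : ℤ) - 1)) q⁻¹ i) := by
  rw [lectureProduct, show (2 * i + 1) / 2 = i by omega, show (2 * i + 1 + 1) / 2 = i + 1 by omega]

theorem lectureProduct_even (q z : F) (n i : ℕ) :
    lectureProduct q z n (2 * i) =
      (z * q ^ i) ^ i * gaussBinom q (n - i) i /
        (qPoch z q i * qPoch (z * q ^ ((n : ℤ) - 1)) q⁻¹ i) := by
  rw [lectureProduct, show 2 * i / 2 = i by omega, show (2 * i + 1) / 2 = i by omega]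

theorem one_sub_mul_lectureProduct_one {q z : F} (hz : 1 - z ≠ 0) (n : ℕ) :
    (1 - z) * lectureProduct q z n 1 = z := by
  have h := lectureProduct_odd q z n 0
  simp only [mul_zero, zero_add] at h
  rw [h]
  simp [qPoch, gaussBinom]
  field_simp

/-- The base of the second Pochhammer symbol is unchanged when `n + 1, z` is replaced by `n, zq`, so
that symbol cancels from the recurrences up to its last factor. -/
theorem shift_base {q : F} (hq : q ≠ 0) (z : F) (n : ℕ) :
    z * q ^ (((n + 1 : ℕ) : ℤ) - 1) = z * q * q ^ ((n : ℤ) - 1) := by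
  rw [mul_assoc, ← zpow_one_add₀ hq]
  congr 2
  push_cast
  ring

theorem one_sub_mul_lectureProduct_odd {q z : F} (hq : q ≠ 0) (hz : 1 - z ≠ 0) (n i : ℕ) :
    (1 - z) * lectureProduct q z (n + 1) (2 * i + 1) =
      z * lectureProduct q (z * q) n (2 * i) := by
  rw [lectureProduct_odd, lectureProduct_even, qPoch_succ', shift_base hq,
    Nat.add_sub_add_right, pow_succ' (z * q ^ i)]
  have e : (z * q * q ^ i) ^ i = q ^ i * (z * q ^ i) ^ i := by ring
  rw [e, mul_assoc (1 - z), mul_div_assoc', mul_div_mul_left _ _ hz]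
  ring

/-- After removal of common factors, with `A = q^(i+1)` and `S = q^s`, this is `(1 - AS)(1 - zA) =
(1 - A)(1 - zAS) + (1 - z) A (1 - S)`. -/
theorem one_sub_mul_lectureProduct_even {q z : F} (hq : q ≠ 0) (hz : ∀ t : ℕ, 1 - z * q ^ t ≠ 0)
    (hq1 : ∀ t : ℕ, 1 - q ^ (t + 1) ≠ 0) {n i : ℕ} (hn : 2 * i + 1 ≤ n) :
    (1 - z) * lectureProduct q z (n + 1) (2 * i + 2) =
      lectureProduct q (z * q) n (2 * i + 1) +
        (1 - z) * lectureProduct q (z * q) n (2 * i + 2) := by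
  obtain ⟨s, rfl⟩ : ∃ s, n = i + s + (i + 1) := ⟨n - (2 * i + 1), by omega⟩
  have e1 : 2 * i + 2 = 2 * (i + 1) := by ring
  rw [e1, lectureProduct_even, lectureProduct_even, lectureProduct_odd, shift_base hq,
    qPoch_succ', qPoch_succ (z * q), Nat.add_sub_cancel,
    show i + s + (i + 1) + 1 - (i + 1) = i + s + 1 by omega]
  have hD : qPoch (z * q * q ^ (((i + s + (i + 1) : ℕ) : ℤ) - 1)) q⁻¹ (i + 1) =
      qPoch (z * q * q ^ (((i + s + (i + 1) : ℕ) : ℤ) - 1)) q⁻¹ i *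
        (1 - z * q ^ (i + s + 1)) := by
    rw [qPoch_succ]
    congr 2
    have : ((i + s + (i + 1) : ℕ) : ℤ) - 1 = ((i + s + i : ℕ) : ℤ) := by
      push_cast
      ring
    rw [this, zpow_natCast, inv_pow]
    field_simp
    ring
  have hg1 : gaussBinom q (i + s + 1) (i + 1) =
      gaussBinom q (i + s) i * (1 - q ^ (i + s + 1)) / (1 - q ^ (i + 1)) := by
    unfold gaussBinom
    have a1 : ((i + s + 1 : ℕ) : ℤ) - ((i + 1 : ℕ) : ℤ) + 1 = ((s + 1 : ℕ) : ℤ) := by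
      push_cast
      ring
    have a2 : ((i + s : ℕ) : ℤ) - (i : ℤ) + 1 = ((s + 1 : ℕ) : ℤ) := by
      push_cast
      ring
    rw [a1, a2, zpow_natCast, qPoch_succ, qPoch_succ, ← pow_add, ← pow_succ',
      show s + 1 + i = i + s + 1 by ring]
    rw [div_mul_eq_mul_div, div_div]
  have hg2 : gaussBinom q (i + s) (i + 1) =
      gaussBinom q (i + s) i * (1 - q ^ s) / (1 - q ^ (i + 1)) := by
    unfold gaussBinom
    have a1 : ((i + s : ℕ) : ℤ) - ((i + 1 : ℕ) : ℤ) + 1 = (s : ℤ) := by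
      push_cast
      ring
    have a2 : ((i + s : ℕ) : ℤ) - (i : ℤ) + 1 = ((s + 1 : ℕ) : ℤ) := by
      push_cast
      ring
    rw [a1, a2, zpow_natCast, zpow_natCast, qPoch_succ', qPoch_succ, ← pow_succ, ← pow_succ',
      div_mul_eq_mul_div, div_div, mul_comm (1 - q ^ s)]
  rw [hD, hg1, hg2]
  generalize qPoch (z * q * q ^ (((i + s + (i + 1) : ℕ) : ℤ) - 1)) q⁻¹ i = D
  generalize gaussBinom q (i + s) i = B
  generalize qPoch (z * q) q i = Q
  have p1 : (z * q * q ^ i) ^ (i + 1) = (z * q ^ (i + 1)) ^ (i + 1) := by ring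
  have p2 : (z * q * q ^ (i + 1)) ^ (i + 1) = (z * q ^ (i + 1)) ^ (i + 1) * q ^ (i + 1) := by
    rw [← mul_pow]
    ring
  rw [p1, p2]
  generalize (z * q ^ (i + 1)) ^ (i + 1) = P
  have h0 : 1 - z ≠ 0 := by simpa using hz 0
  have h1 := hz (i + s + 1)
  have h2 : 1 - z * q * q ^ i ≠ 0 := by
    have := hz (i + 1)
    rwa [pow_succ', ← mul_assoc] at this
  have h3 := hq1 i
  -- `Q` and `D` divide every term, and division by zero is zero, so their nonvanishing is not
  -- needed.
  rcases eq_or_ne Q 0 with rfl | hQ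
  · simp
  rcases eq_or_ne D 0 with rfl | hD0
  · simp
  field_simp
  ring

/-- The numerator of the Gaussian binomial starts with the factor `1 - q^0`. -/
theorem lectureProduct_eq_zero (q z : F) (i : ℕ) :
    lectureProduct q z (2 * i + 1) (2 * i + 2) = 0 := by
  have h := lectureProduct_even q z (2 * i + 1) (i + 1)
  rw [show 2 * (i + 1) = 2 * i + 2 by ring, show 2 * i + 1 - (i + 1) = i by omega] at h
  rw [h, gaussBinom, show ((i : ℤ) - ((i + 1 : ℕ) : ℤ) + 1) = 0 by push_cast; ring, zpow_zero,
    qPoch_succ']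
  simp

end ProductFormula

/-! ### Comparison of series and products -/

theorem algebraMap_one_sub_ne_zero {f : MvPowerSeries (Fin 2) ℤ}
    (hf : MvPowerSeries.constantCoeff f = 0) : 1 - algebraMap _ SeriesField f ≠ 0 := by
  rw [← map_one (algebraMap (MvPowerSeries (Fin 2) ℤ) SeriesField), ← map_sub,
    map_ne_zero_iff _ algebraMap_seriesField_injective]
  intro h
  have := congrArg MvPowerSeries.constantCoeff h
  simp [hf] at this

theorem one_sub_zField_mul_ne_zero (r t : ℕ) : 1 - zField r * (varX * varY) ^ t ≠ 0 := by
  have h := algebraMap_one_sub_ne_zero (f := zSeries (r + t)) (by simp [zSeries])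
  rwa [algebraMap_zSeries, zField, pow_add, ← mul_assoc] at h

theorem one_sub_varX_mul_varY_pow_ne_zero (t : ℕ) : 1 - (varX * varY) ^ (t + 1) ≠ 0 := by
  have h := algebraMap_one_sub_ne_zero
    (f := (MvPowerSeries.X 0 * MvPowerSeries.X 1) ^ (t + 1)) (by simp)
  simpa [varX, varY] using h

/-- Induction on `n` for all `r` at once, since each step replaces `r` by `r + 1`; the recurrences
determine the series because `1 - z` is nonzero. -/
theorem algebraMap_lectureSeries (r : ℕ) {n k : ℕ} (hk : k < n) :
    algebraMap _ SeriesField (lectureSeries r n k) =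
      lectureProduct (varX * varY) (zField r) n (k + 1) := by
  induction n generalizing r k with
  | zero => omega
  | succ n ih =>
    have hq : varX * varY ≠ 0 := mul_ne_zero varX_ne_zero varY_ne_zero
    have hz := one_sub_zField_mul_ne_zero r
    have h0 : 1 - zField r ≠ 0 := by simpa using hz 0
    have hs : zField (r + 1) = zField r * (varX * varY) := by
      simp only [zField]
      ring
    refine mul_left_cancel₀ h0 ?_
    rcases k with _ | k
    · rw [zero_add, one_sub_mul_lectureProduct_one h0, ← algebraMap_zSeries, ← map_one
        (algebraMap (MvPowerSeries (Fin 2) ℤ) SeriesField), ← map_sub, ← map_mul,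
        one_sub_mul_lectureSeries_zero]
    · rcases Nat.even_or_odd' k with ⟨i, rfl | rfl⟩
      · have h := congrArg (algebraMap (MvPowerSeries (Fin 2) ℤ) SeriesField)
          (one_sub_mul_lectureSeries_odd r (n := n) (i := i) (by omega))
        simp only [map_mul, map_add, map_sub, map_one, algebraMap_zSeries] at h
        rw [h, one_sub_mul_lectureProduct_even hq hz one_sub_varX_mul_varY_pow_ne_zero (by omega),
          ih _ (by omega), hs]
        congr 2
        rcases Nat.lt_or_ge (2 * i + 1) n with hlt | hge
        · rw [ih _ hlt, hs]
        -- The extra term asks for more positive parts than the parameter admits: both its series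
        -- and its product vanish.
        · obtain rfl : n = 2 * i + 1 := by omega
          rw [lectureSeries_self _ (by omega), lectureProduct_eq_zero, map_zero]
      · have h := congrArg (algebraMap (MvPowerSeries (Fin 2) ℤ) SeriesField)
          (one_sub_mul_lectureSeries_even r (n := n) (i := i) (by omega))
        simp only [map_mul, map_sub, map_one, algebraMap_zSeries] at h
        have e : 2 * i + 1 + 1 + 1 = 2 * (i + 1) + 1 := by ring
        rw [h, e, one_sub_mul_lectureProduct_odd hq h0, ih _ (by omega), hs]
        rfl

theorem oddEvenGF_positive {n k : ℕ} (hk : k ≤ n) :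
    oddEvenGF (positiveTruncatedLectureHall n k) =
      (varX ^ (k / 2 + 1) * varY ^ (k / 2)) ^ ((k + 1) / 2) *
          gaussBinom (varX * varY) (n - (k + 1) / 2) (k / 2) /
        (qPoch varX (varX * varY) ((k + 1) / 2) *
          qPoch (varX ^ n * varY ^ ((n : ℤ) - 1)) (varX * varY)⁻¹ (k / 2)) := by
  -- `lectureSeries` always has at least one part, so the empty partition is treated separately.
  rcases k with _ | k
  · have h : oddEvenSeries (positiveTruncatedLectureHall n 0) = 1 := by
      ext d
      rw [MvPowerSeries.coeff_one]
      change ((Set.ncard _ : ℕ) : ℤ) = _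
      have e : d = 0 ↔ d 0 = 0 ∧ d 1 = 0 := by simp [Finsupp.ext_iff]
      split_ifs with hd
      · rw [Nat.cast_eq_one, Set.ncard_eq_one]
        refine ⟨Fin.elim0, Set.eq_singleton_iff_unique_mem.2 ⟨?_, fun l _ => Subsingleton.elim _ _⟩⟩
        refine ⟨⟨⟨fun i => i.elim0, fun i => i.elim0⟩, fun i => i.elim0⟩, ?_, ?_⟩ <;>
          simp [oddWeight, evenWeight, hd]
      · rw [Nat.cast_eq_zero, Set.ncard_eq_zero (finite_oddWeight_evenWeight _ _ _),
          Set.eq_empty_iff_forall_notMem]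
        rintro l ⟨-, h1, h2⟩
        simp only [oddWeight, evenWeight, Finset.univ_eq_empty, Finset.sum_empty] at h1 h2
        exact hd (e.2 ⟨h1.symm, h2.symm⟩)
    simp [oddEvenGF, h, qPoch, gaussBinom]
  · rw [oddEvenGF, oddEvenSeries_eq_lectureSeries hk, algebraMap_lectureSeries 0 hk, lectureProduct]
    have hx := varX_ne_zero
    have e1 : zField 0 * (varX * varY) ^ ((k + 1) / 2) =
        varX ^ ((k + 1) / 2 + 1) * varY ^ ((k + 1) / 2) := by
      simp only [zField]
      ring
    have e2 : zField 0 * (varX * varY) ^ ((n : ℤ) - 1) = varX ^ n * varY ^ ((n : ℤ) - 1) := by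
      rw [mul_zpow, ← mul_assoc, ← zpow_natCast varX n]
      congr 1
      rw [zField, pow_zero, mul_one, ← zpow_one_add₀ hx]
      congr 1
      ring
    rw [e1, e2]
    simp [zField]

/-! ### Partitions with zero parts -/

theorem snoc_zero_mem_iff {n k : ℕ} (hk : k < n) {l : Fin k → ℕ} :
    (Fin.snoc l 0 : Fin (k + 1) → ℕ) ∈ truncatedLectureHall n (k + 1) ↔
      l ∈ truncatedLectureHall n k := by
  constructor
  · rintro ⟨h1, h2⟩
    refine ⟨fun i j hij => ?_, fun i j hij => ?_⟩
    · simpa using h1 (Fin.castSucc_le_castSucc_iff.2 hij)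
    · simpa using h2 i.castSucc j.castSucc (by simpa using hij)
  · rintro ⟨h1, h2⟩
    refine ⟨fun i j hij => ?_, fun i j hij => ?_⟩
    · induction j using Fin.lastCases with
      | last => simp
      | cast j =>
        induction i using Fin.lastCases with
        | last => exact absurd hij (by simp [Fin.le_def])
        | cast i => simpa using h1 (Fin.castSucc_le_castSucc_iff.1 hij)
    · induction j using Fin.lastCases with
      | last =>
        have : (0 : ℚ) ≤ (n : ℚ) - (i : ℕ) := by
          rw [sub_nonneg]
          exact_mod_cast (by omega : (i : ℕ) ≤ n)
        simp only [Fin.snoc_last, Nat.cast_zero, zero_div]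
        positivity
      | cast j =>
        induction i using Fin.lastCases with
        | last => simp at hij; omega
        | cast i => simpa using h2 i j (by simpa using hij)

theorem oddWeight_snoc_zero {k : ℕ} (l : Fin k → ℕ) :
    oddWeight (Fin.snoc l 0 : Fin (k + 1) → ℕ) = oddWeight l := by
  simp [oddWeight, Fin.sum_univ_castSucc]

theorem evenWeight_snoc_zero {k : ℕ} (l : Fin k → ℕ) :
    evenWeight (Fin.snoc l 0 : Fin (k + 1) → ℕ) = evenWeight l := by
  simp [evenWeight, Fin.sum_univ_castSucc]

/-- Either the last part is zero and can be dropped without changing the weights, or it is positive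
and by monotonicity so are all others. -/
theorem oddEvenSeries_truncated_succ {n k : ℕ} (hk : k < n) :
    oddEvenSeries (truncatedLectureHall n (k + 1)) =
      oddEvenSeries (truncatedLectureHall n k) +
        oddEvenSeries (positiveTruncatedLectureHall n (k + 1)) := by
  ext d
  change ((Set.ncard _ : ℕ) : ℤ) = ((Set.ncard _ : ℕ) : ℤ) + ((Set.ncard _ : ℕ) : ℤ)
  have hinj : Function.Injective fun l : Fin k → ℕ => (Fin.snoc l 0 : Fin (k + 1) → ℕ) :=
    fun s t h => (Fin.snoc_inj.1 h).1
  rw [← Set.ncard_image_of_injective _ hinj, ← Nat.cast_add, Nat.cast_inj,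
    ← Set.ncard_union_eq _ ((finite_oddWeight_evenWeight _ _ _).image _)
      (finite_oddWeight_evenWeight _ _ _)]
  · congr 1
    ext l
    simp only [Set.mem_union, Set.mem_image, Set.mem_ofPred_eq]
    constructor
    · rintro ⟨h1, h2⟩
      rcases Nat.eq_zero_or_pos (l (Fin.last k)) with h | h
      · left
        have e : (Fin.snoc (Fin.init l) 0 : Fin (k + 1) → ℕ) = l := by
          rw [← h, Fin.snoc_init_self]
        refine ⟨Fin.init l, ⟨?_, ?_⟩, e⟩
        · rwa [← snoc_zero_mem_iff hk, e]
        · rwa [← oddWeight_snoc_zero, ← evenWeight_snoc_zero, e]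
      · exact Or.inr ⟨⟨h1, fun i => h.trans_le (h1.1 (Fin.le_last i))⟩, h2⟩
    · rintro (⟨t, ⟨h1, h2⟩, rfl⟩ | ⟨h1, h2⟩)
      · rw [oddWeight_snoc_zero, evenWeight_snoc_zero]
        exact ⟨(snoc_zero_mem_iff hk).2 h1, h2⟩
      · exact ⟨h1.1, h2⟩
  · rw [Set.disjoint_left]
    rintro _ ⟨t, -, rfl⟩ ⟨h, -⟩
    simpa using h.2 (Fin.last k)

theorem oddEvenGF_truncated {n k : ℕ} (hk : k ≤ n) :
    oddEvenGF (truncatedLectureHall n k) =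
      ∑ m ∈ Finset.range (k + 1), oddEvenGF (positiveTruncatedLectureHall n m) := by
  induction k with
  | zero =>
    have h : truncatedLectureHall n 0 = positiveTruncatedLectureHall n 0 :=
      Set.ext fun l => ⟨fun h => ⟨h, fun i => i.elim0⟩, fun h => h.1⟩
    simp [h]
  | succ k ih =>
    rw [Finset.sum_range_succ, ← ih (by omega), oddEvenGF, oddEvenSeries_truncated_succ hk, map_add]
    rfl

theorem mainTheorem3 (n k : ℕ) (hkn : k ≤ n) :
    oddEvenGF (positiveTruncatedLectureHall n k) =
      (varX ^ (k / 2 + 1) * varY ^ (k / 2)) ^ ((k + 1) / 2) *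
          gaussBinom (varX * varY) (n - (k + 1) / 2) (k / 2) /
        (qPoch varX (varX * varY) ((k + 1) / 2) *
          qPoch (varX ^ n * varY ^ ((n : ℤ) - 1)) (varX * varY)⁻¹ (k / 2)) ∧
    oddEvenGF (truncatedLectureHall n k) =
      ∑ m ∈ Finset.range (k + 1),
        (varX ^ (m / 2 + 1) * varY ^ (m / 2)) ^ ((m + 1) / 2) *
            gaussBinom (varX * varY) (n - (m + 1) / 2) (m / 2) /
          (qPoch varX (varX * varY) ((m + 1) / 2) *
            qPoch (varX ^ n * varY ^ ((n : ℤ) - 1)) (varX * varY)⁻¹ (m / 2)) := by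
  refine ⟨oddEvenGF_positive hkn, ?_⟩
  rw [oddEvenGF_truncated hkn]
  refine Finset.sum_congr rfl fun m hm => oddEvenGF_positive ?_
  have := Finset.mem_range.1 hm
  omega
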